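/- Let $k$ be a commutative artinian ring and let $(\mathcal C,\mathbb E,\mathfrak s)$ be a $k$-linear extriangulated category (in the sense of Nakaoka–Palu) which is Krull–Schmidt (every object is a finite direct sum of objects with local endomorphism rings) and Ext-finite ($\mathbb E(A,B)$ is a finitely generated $k$-module for all $A,B\in\mathcal C$). Assume that the following condition (WIC) holds: for all composable morphisms $f\colon A\to B$ and $g\colon B\to C$, if $g\circ f$ is an $\mathfrak s$-inflation then so is $f$, and if $g\circ f$ is an $\mathfrak s$-deflation then so is $g$. A morphism $f\colon A\to A'$ is called $\mathfrak s$-injective if $\mathbb E(B,f)=0$ for all $B\in\mathcal C$; let $\overline{\mathcal C}=\mathcal C/\mathcal I$ be the quotient of $\mathcal C$ by the ideal $\mathcal I$ of $\mathfrak s$-injective morphisms. An object $P$ is called $\mathfrak s$-projective if $\mathbb E(P,A)=0$ for all $A\in\mathcal C$. Let $\check k$ be the minimal injective cogenerator for finitely generated $k$-modules (the injective hull of $k/\operatorname{rad}k$), let $D=\operatorname{Hom}_k(-,\check k)$, and let $\mathcal C_r$ be the full subcategory of $\mathcal C$ consisting of all objects $X$ such that the contravariant functor $D\mathbb E(X,-)$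 from $\overline{\mathcal C}$ to $k$-modules is representable, that is, isomorphic to $\overline{\mathcal C}(-,X')$ for some object $X'$. An object $C$ is called a right determiner of a morphism $f\colon X\to Y$ if every morphism $g\colon T\to Y$ such that $g\circ h$ factors through $f$ for all $h\colon C\to T$ itself factors through $f$. A right determiner $C$ of $f$ is called minimal if $C$ is a direct summand of every right determiner of $f$. Let $\alpha\colon X\to Y$ be an $\mathfrak s$-deflation and let $C$ be a minimal right determiner of $\alpha$. Then $C$ has no non-zero $\mathfrak s$-projective direct summands, and $C\in\mathcal C_r$. -/

import Mathlib

open CategoryTheory CategoryTheory.Limits Opposite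

universe u v

/-! ### The duality `D = Hom_k(-, ǩ)` -/

/-- `I` is an injective hull of the `k`-module `M`: it is injective and contains (a copy of) `M`
as an essential submodule. -/
def IsInjectiveHull (k : Type v) [CommRing k] (M I : Type v) [AddCommGroup M] [Module k M]
    [AddCommGroup I] [Module k I] : Prop :=
  Module.Injective k I ∧ ∃ i : M →ₗ[k] I, Function.Injective i ∧
    ∀ N : Submodule k I, N ⊓ LinearMap.range i = ⊥ → N = ⊥

theorem exists_isInjectiveHull (k : Type v) [CommRing k] (M : Type v) [AddCommGroup M]
    [Module k M] : ∃ I : ModuleCat.{v} k, IsInjectiveHull k M I := by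
  obtain ⟨pres⟩ := EnoughInjectives.presentation (ModuleCat.of k M)
  let Q : ModuleCat.{v} k := pres.J
  have hQ' : Injective (ModuleCat.of k Q) := pres.injective
  have hQ : Module.Injective k Q := Module.injective_module_of_injective_object k Q
  let j : M →ₗ[k] Q := pres.f.hom
  have hj : Function.Injective j := (ModuleCat.mono_iff_injective pres.f).1 inferInstance
  obtain ⟨N, hjN, hN⟩ := zorn_le_nonempty₀ {N : Submodule k Q | LinearMap.range j ≤ N ∧
      ∀ K ≤ N, K ⊓ LinearMap.range j = ⊥ → K = ⊥} (by
    intro c hc hch y hy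
    refine ⟨sSup c, ⟨(hc hy).1.trans (le_sSup hy), fun K hK hKj => ?_⟩, fun z hz => le_sSup hz⟩
    rw [eq_bot_iff]
    intro x hx
    obtain ⟨z, hz, hxz⟩ := (Submodule.mem_sSup_of_directed ⟨y, hy⟩ hch.directedOn).1 (hK hx)
    have h1 : Submodule.span k {x} = ⊥ := by
      refine (hc hz).2 _ ((Submodule.span_singleton_le_iff_mem _ _).2 hxz) ?_
      rw [eq_bot_iff, ← hKj]
      exact inf_le_inf_right _ ((Submodule.span_singleton_le_iff_mem _ _).2 hx)
    rw [← h1]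
    exact Submodule.mem_span_singleton_self x) (LinearMap.range j) ⟨le_rfl, fun K hK h => by
      rwa [inf_eq_left.2 hK] at h⟩
  obtain ⟨P, -, hP⟩ := zorn_le_nonempty₀ {P : Submodule k Q | P ⊓ N = ⊥} (by
    intro c hc hch y hy
    refine ⟨sSup c, ?_, fun z hz => le_sSup hz⟩
    change sSup c ⊓ N = ⊥
    rw [eq_bot_iff]
    rintro x ⟨hx, hxN⟩
    obtain ⟨z, hz, hxz⟩ := (Submodule.mem_sSup_of_directed ⟨y, hy⟩ hch.directedOn).1 hx
    have h2 : z ⊓ N = ⊥ := hc hz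
    rw [← h2]
    exact ⟨hxz, hxN⟩) ⊥ (by simp)
  have hPN : P ⊓ N = ⊥ := hP.prop
  have hPmax : ∀ L : Submodule k Q, P ≤ L → L ⊓ N = ⊥ → L ≤ P := fun L h1 h2 =>
    hP.le_of_ge h2 h1
  have hφ : Function.Injective (P.mkQ ∘ₗ N.subtype) := by
    rw [← LinearMap.ker_eq_bot, eq_bot_iff]
    intro x hx
    have hx1 : (x : Q) ∈ P := by simpa using hx
    have hx2 : (x : Q) ∈ P ⊓ N := ⟨hx1, x.2⟩
    rw [hPN] at hx2
    simpa using hx2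
  obtain ⟨h, hh⟩ := hQ.out (P.mkQ ∘ₗ N.subtype) hφ N.subtype
  have hh' : ∀ x ∈ N, h (P.mkQ x) = x := fun x hx => hh ⟨x, hx⟩
  have hNle : N ≤ LinearMap.range h := fun x hx => ⟨P.mkQ x, hh' x hx⟩
  have hmem : LinearMap.range h ≤ N := by
    refine hN.le_of_ge ⟨hjN.trans hNle, fun K hK hKj => ?_⟩ hNle
    have h1 : K ⊓ N = ⊥ := hN.prop.2 _ inf_le_right (by
      rw [eq_bot_iff, ← hKj]
      exact inf_le_inf_right _ inf_le_left)
    have h2 : K.comap (h ∘ₗ P.mkQ) ≤ P := by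
      refine hPmax _ (fun x hx => ?_) ?_
      · have : P.mkQ x = 0 := by simpa using hx
        simp only [Submodule.mem_comap, LinearMap.comp_apply, this, map_zero]
        exact K.zero_mem
      · rw [eq_bot_iff, ← h1]
        rintro x ⟨hx, hxN⟩
        have hx' : h (P.mkQ x) ∈ K := hx
        rw [hh' x hxN] at hx'
        exact ⟨hx', hxN⟩
    rw [eq_bot_iff]
    intro y hy
    obtain ⟨q, rfl⟩ := hK hy
    obtain ⟨q, rfl⟩ := P.mkQ_surjective q
    have : P.mkQ q = 0 := by simpa using h2 hy
    simp [this]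
  let r : Q →ₗ[k] N := (h ∘ₗ P.mkQ).codRestrict N fun q => hmem ⟨_, rfl⟩
  have hr : ∀ x : N, r x = x := fun x => Subtype.ext (hh' x x.2)
  refine ⟨ModuleCat.of k N, ⟨fun X Y _ _ _ _ f hf g => ?_⟩,
    j.codRestrict N fun m => hjN ⟨m, rfl⟩, fun a b hab => hj (congrArg Subtype.val hab), ?_⟩
  · obtain ⟨g', hg'⟩ := hQ.out f hf (N.subtype ∘ₗ g)
    exact ⟨r ∘ₗ g', fun x => by
      rw [LinearMap.comp_apply, hg']
      exact hr (g x)⟩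
  · intro K hK
    have h1 : K.map N.subtype = ⊥ := by
      refine hN.prop.2 _ (Submodule.map_subtype_le _ _) ?_
      rw [eq_bot_iff]
      rintro _ ⟨⟨x, hx, rfl⟩, ⟨m, hm⟩⟩
      have hx2 : x ∈ K ⊓ LinearMap.range (j.codRestrict N fun m => hjN ⟨m, rfl⟩) :=
        ⟨hx, m, Subtype.ext hm⟩
      have hx3 : x = 0 := by
        have := hK.le hx2
        simpa using this
      simp [hx3]
    exact Submodule.map_injective_of_injective N.injective_subtype (by rw [h1, Submodule.map_bot])

/-- The minimal injective cogenerator `ǩ` for finitely generated modules over a commutative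
artinian ring `k`: the injective hull of `k / rad k`, where `rad k` is the Jacobson radical. -/
noncomputable def minInjCogen (k : Type v) [CommRing k] : ModuleCat.{v} k :=
  (exists_isInjectiveHull k (k ⧸ Ring.jacobson k)).choose

/-- The contravariant functor `D = Hom_k(-, ǩ)` on `k`-modules. -/
noncomputable def dualFunctor (k : Type v) [CommRing k] :
    (ModuleCat.{v} k)ᵒᵖ ⥤ ModuleCat.{v} k :=
  (linearYoneda k (ModuleCat.{v} k)).obj (minInjCogen k)

/-! ### Additive categories, direct summands, right determiners -/

section Additive

variable {𝒞 : Type u} [Category.{v} 𝒞]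

/-- Every object is a finite direct sum of objects with local endomorphism rings. -/
def IsKrullSchmidt (𝒞 : Type u) [Category.{v} 𝒞] [Preadditive 𝒞] [HasFiniteBiproducts 𝒞] : Prop :=
  ∀ X : 𝒞, ∃ (n : ℕ) (Z : Fin n → 𝒞),
    (∀ i, IsLocalRing (End (Z i))) ∧ Nonempty (X ≅ ⨁ Z)

attribute [local instance] hasBinaryBiproducts_of_finite_biproducts

/-- `P` is a direct summand of `C`. -/
def IsDirectSummand [Preadditive 𝒞] [HasFiniteBiproducts 𝒞] (P C : 𝒞) : Prop :=
  ∃ Z : 𝒞, Nonempty (C ≅ P ⊞ Z)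

/-- `g` factors through `f`. -/
def FactorsThrough {T X Y : 𝒞} (g : T ⟶ Y) (f : X ⟶ Y) : Prop :=
  ∃ t : T ⟶ X, t ≫ f = g

/-- `f` is right `C`-determined, i.e. `C` is a right determiner of `f`. -/
def IsRightDeterminer (C : 𝒞) {X Y : 𝒞} (f : X ⟶ Y) : Prop :=
  ∀ (T : 𝒞) (g : T ⟶ Y), (∀ h : C ⟶ T, FactorsThrough (h ≫ g) f) → FactorsThrough g f

/-- `C` is a minimal right determiner of `f`. -/
def IsMinimalRightDeterminer [Preadditive 𝒞] [HasFiniteBiproducts 𝒞]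
    (C : 𝒞) {X Y : 𝒞} (f : X ⟶ Y) : Prop :=
  IsRightDeterminer C f ∧ ∀ C' : 𝒞, IsRightDeterminer C' f → IsDirectSummand C C'

/-! ### Sequences `A ⟶ B ⟶ C` with fixed end terms, up to equivalence -/

/-- A sequence `A ⟶ mid ⟶ C`. -/
structure ShortSeq (A C : 𝒞) where
  mid : 𝒞
  inc : A ⟶ mid
  proj : mid ⟶ C

/-- Two sequences with the same end terms are equivalent if there is an isomorphism of the middle
terms compatible with the identities of the end terms. -/
def seqSetoid (A C : 𝒞) : Setoid (ShortSeq A C) where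
  r S T := ∃ b : S.mid ≅ T.mid, S.inc ≫ b.hom = T.inc ∧ b.hom ≫ T.proj = S.proj
  iseqv :=
    { refl := fun S => ⟨Iso.refl _, by simp, by simp⟩
      symm := by
        rintro S T ⟨b, h1, h2⟩
        exact ⟨b.symm, by simp [← h1], by simp [← h2]⟩
      trans := by
        rintro S T U ⟨b, h1, h2⟩ ⟨c, h3, h4⟩
        exact ⟨b ≪≫ c, by simp [← h3, ← h1], by simp [← h2, ← h4]⟩ }

/-- The equivalence class `[A ⟶ B ⟶ C]`. -/
def seqClass {A B C : 𝒞} (x : A ⟶ B) (y : B ⟶ C) : _root_.Quotient (seqSetoid A C) :=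
  _root_.Quotient.mk (seqSetoid A C) ⟨B, x, y⟩

end Additive

/-! ### Extensions -/

section Ext

variable {k : Type v} [CommRing k] {𝒞 : Type u} [Category.{v} 𝒞]
  (E : 𝒞ᵒᵖ ⥤ 𝒞 ⥤ ModuleCat.{v} k)

/-- The `k`-module `𝔼(C, A)` of extensions. -/
abbrev ExtOf (C A : 𝒞) : Type v := (E.obj (op C)).obj A

/-- `push E C a δ` is `a_⋆ δ`. -/
def push (C : 𝒞) {A A' : 𝒞} (a : A ⟶ A') : ExtOf E C A →ₗ[k] ExtOf E C A' :=
  ((E.obj (op C)).map a).hom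

/-- `pull E A c δ` is `c^⋆ δ`. -/
def pull (A : 𝒞) {C C' : 𝒞} (c : C' ⟶ C) : ExtOf E C A →ₗ[k] ExtOf E C' A :=
  ((E.map c.op).app A).hom

attribute [local instance] hasBinaryBiproducts_of_finite_biproducts

/-- The extension `δ ⊕ δ'` in `𝔼(C ⊞ C', A ⊞ A')` whose components in `𝔼(C, A)`, `𝔼(C, A')`,
`𝔼(C', A)`, `𝔼(C', A')` are `δ, 0, 0, δ'`. -/
noncomputable def extSum [Preadditive 𝒞] [HasFiniteBiproducts 𝒞] {A A' C C' : 𝒞}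
    (δ : ExtOf E C A) (δ' : ExtOf E C' A') : ExtOf E (C ⊞ C') (A ⊞ A') :=
  pull E (A ⊞ A') biprod.fst (push E C biprod.inl δ) +
    pull E (A ⊞ A') biprod.snd (push E C' biprod.inr δ')

end Ext

attribute [local instance] hasBinaryBiproducts_of_finite_biproducts in
/-- A `k`-linear extriangulated structure on a `k`-linear additive category `𝒞`. -/
structure Extriangulated (k : Type v) [CommRing k] (𝒞 : Type u) [Category.{v} 𝒞]
    [Preadditive 𝒞] [Linear k 𝒞] [HasFiniteBiproducts 𝒞] where
  /-- (ET1) The bifunctor `𝔼`, which is `k`-linear in each variable. -/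
  E : 𝒞ᵒᵖ ⥤ 𝒞 ⥤ ModuleCat.{v} k
  push_add : ∀ {C A A' : 𝒞} (a b : A ⟶ A') (δ : ExtOf E C A),
    push E C (a + b) δ = push E C a δ + push E C b δ
  push_smul : ∀ {C A A' : 𝒞} (r : k) (a : A ⟶ A') (δ : ExtOf E C A),
    push E C (r • a) δ = r • push E C a δ
  pull_add : ∀ {C C' A : 𝒞} (c d : C' ⟶ C) (δ : ExtOf E C A),
    pull E A (c + d) δ = pull E A c δ + pull E A d δ
  pull_smul : ∀ {C C' A : 𝒞} (r : k) (c : C' ⟶ C) (δ : ExtOf E C A),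
    pull E A (r • c) δ = r • pull E A c δ
  /-- The correspondence `𝔰`. -/
  s : ∀ {A C : 𝒞}, ExtOf E C A → _root_.Quotient (seqSetoid A C)
  /-- (R) `𝔰` is a realization of `𝔼`. -/
  realization : ∀ {A B C A' B' C' : 𝒞} {x : A ⟶ B} {y : B ⟶ C} {x' : A' ⟶ B'} {y' : B' ⟶ C'}
    {δ : ExtOf E C A} {δ' : ExtOf E C' A'}, s δ = seqClass x y → s δ' = seqClass x' y' →
    ∀ (a : A ⟶ A') (c : C ⟶ C'), push E C a δ = pull E A' c δ' →
      ∃ b : B ⟶ B', x ≫ b = a ≫ x' ∧ y ≫ c = b ≫ y'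
  /-- (ET2) The realization is additive. -/
  s_zero : ∀ A C : 𝒞, s (0 : ExtOf E C A) =
    seqClass (biprod.inl : A ⟶ A ⊞ C) (biprod.snd : A ⊞ C ⟶ C)
  s_sum : ∀ {A B C A' B' C' : 𝒞} {x : A ⟶ B} {y : B ⟶ C} {x' : A' ⟶ B'} {y' : B' ⟶ C'}
    {δ : ExtOf E C A} {δ' : ExtOf E C' A'}, s δ = seqClass x y → s δ' = seqClass x' y' →
    s (extSum E δ δ') = seqClass (biprod.map x x') (biprod.map y y')
  /-- (ET3) -/
  et3 : ∀ {A B C A' B' C' : 𝒞} {x : A ⟶ B} {y : B ⟶ C} {x' : A' ⟶ B'} {y' : B' ⟶ C'}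
    {δ : ExtOf E C A} {δ' : ExtOf E C' A'}, s δ = seqClass x y → s δ' = seqClass x' y' →
    ∀ (a : A ⟶ A') (b : B ⟶ B'), x ≫ b = a ≫ x' →
      ∃ c : C ⟶ C', y ≫ c = b ≫ y' ∧ push E C a δ = pull E A' c δ'
  /-- (ET3)ᵒᵖ -/
  et3_op : ∀ {A B C A' B' C' : 𝒞} {x : A ⟶ B} {y : B ⟶ C} {x' : A' ⟶ B'} {y' : B' ⟶ C'}
    {δ : ExtOf E C A} {δ' : ExtOf E C' A'}, s δ = seqClass x y → s δ' = seqClass x' y' →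
    ∀ (b : B ⟶ B') (c : C ⟶ C'), y ≫ c = b ≫ y' →
      ∃ a : A ⟶ A', x ≫ b = a ≫ x' ∧ push E C a δ = pull E A' c δ'
  /-- (ET4) -/
  et4 : ∀ {A B C D F : 𝒞} {x : A ⟶ B} {y : B ⟶ C} {m : B ⟶ D} {n : D ⟶ F}
    {δ : ExtOf E C A} {ρ : ExtOf E F B}, s δ = seqClass x y → s ρ = seqClass m n →
    ∃ (G : 𝒞) (ξ : ExtOf E G A) (z : A ⟶ D) (w : D ⟶ G) (p : C ⟶ G) (q : G ⟶ F),
      s ξ = seqClass z w ∧ x ≫ m = z ∧ y ≫ p = m ≫ w ∧ w ≫ q = n ∧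
      s (push E F y ρ) = seqClass p q ∧ pull E A p ξ = δ ∧ push E G x ξ = pull E B q ρ
  /-- (ET4)ᵒᵖ -/
  et4_op : ∀ {F D B A C : 𝒞} {n : F ⟶ D} {m : D ⟶ B} {y : B ⟶ A} {x : C ⟶ B}
    {δ : ExtOf E A C} {ρ : ExtOf E B F}, s δ = seqClass x y → s ρ = seqClass n m →
    ∃ (G : 𝒞) (ξ : ExtOf E A G) (w : G ⟶ D) (z : D ⟶ A) (q : F ⟶ G) (p : G ⟶ C),
      s ξ = seqClass w z ∧ m ≫ y = z ∧ p ≫ x = w ≫ m ∧ q ≫ w = n ∧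
      s (pull E F x ρ) = seqClass q p ∧ push E A p ξ = δ ∧ pull E G y ξ = push E B q ρ

namespace Extriangulated

variable {k : Type v} [CommRing k] {𝒞 : Type u} [Category.{v} 𝒞]
  [Preadditive 𝒞] [Linear k 𝒞] [HasFiniteBiproducts 𝒞] (S : Extriangulated k 𝒞)

/-- Every `𝔼(C, A)` is a finitely generated `k`-module. -/
def ExtFinite : Prop := ∀ C A : 𝒞, Module.Finite k (ExtOf S.E C A)

/-- `x` is an `𝔰`-inflation. -/
def IsInflation {A B : 𝒞} (x : A ⟶ B) : Prop :=
  ∃ (C : 𝒞) (y : B ⟶ C) (δ : ExtOf S.E C A), S.s δ = seqClass x y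

/-- `y` is an `𝔰`-deflation. -/
def IsDeflation {B C : 𝒞} (y : B ⟶ C) : Prop :=
  ∃ (A : 𝒞) (x : A ⟶ B) (δ : ExtOf S.E C A), S.s δ = seqClass x y

/-- The condition (WIC). -/
def WIC : Prop :=
  (∀ {A B C : 𝒞} (f : A ⟶ B) (g : B ⟶ C), S.IsInflation (f ≫ g) → S.IsInflation f) ∧
  (∀ {A B C : 𝒞} (f : A ⟶ B) (g : B ⟶ C), S.IsDeflation (f ≫ g) → S.IsDeflation g)

/-- `f` is an `𝔰`-projective morphism: `𝔼(f, A) = 0` for all `A`. -/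
def IsProjectiveMor {C' C : 𝒞} (f : C' ⟶ C) : Prop :=
  ∀ A : 𝒞, pull S.E A f = 0

/-- `f` is an `𝔰`-injective morphism: `𝔼(C, f) = 0` for all `C`. -/
def IsInjectiveMor {A A' : 𝒞} (f : A ⟶ A') : Prop :=
  ∀ C : 𝒞, push S.E C f = 0

/-- `P` is an `𝔰`-projective object. -/
def IsProjectiveObj (P : 𝒞) : Prop := S.IsProjectiveMor (𝟙 P)

/-- Morphisms are identified in the costable category when they differ by an `𝔰`-injective
morphism. -/
def costableRel : HomRel 𝒞 := fun _ _ f g => S.IsInjectiveMor (f - g)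

lemma costableRel_iff {X Y : 𝒞} (f g : X ⟶ Y) :
    S.costableRel f g ↔ ∀ C : 𝒞, push S.E C f = push S.E C g := by
  refine forall_congr' fun C => ?_
  have h : push S.E C f = push S.E C (f - g) + push S.E C g := by
    ext δ
    rw [LinearMap.add_apply, ← S.push_add, sub_add_cancel]
  rw [h]
  simp

lemma push_comp (C : 𝒞) {X Y Z : 𝒞} (f : X ⟶ Y) (g : Y ⟶ Z) :
    push S.E C (f ≫ g) = push S.E C g ∘ₗ push S.E C f := by
  simp [push]

instance : Congruence S.costableRel where
  comp_left f g g' h := by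
    rw [costableRel_iff] at h ⊢
    intro C
    rw [push_comp, push_comp, h C]
  comp_right g h := by
    rw [costableRel_iff] at h ⊢
    intro C
    rw [push_comp, push_comp, h C]
  equivalence :=
    { refl := fun f => (S.costableRel_iff f f).2 fun _ => rfl
      symm := fun h => (S.costableRel_iff _ _).2 fun C => ((S.costableRel_iff _ _).1 h C).symm
      trans := fun h h' => (S.costableRel_iff _ _).2 fun C =>
        ((S.costableRel_iff _ _).1 h C).trans ((S.costableRel_iff _ _).1 h' C) }

/-- The costable category `𝒞 / ℐ`. -/
abbrev Costable : Type u := CategoryTheory.Quotient S.costableRel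

lemma costableRel_add {X Y : 𝒞} (f₁ f₂ g₁ g₂ : X ⟶ Y) (hf : S.costableRel f₁ f₂)
    (hg : S.costableRel g₁ g₂) : S.costableRel (f₁ + g₁) (f₂ + g₂) := by
  rw [costableRel_iff] at *
  intro C
  ext δ
  rw [S.push_add, S.push_add, hf, hg]

lemma costableRel_smul (r : k) {X Y : 𝒞} (f g : X ⟶ Y) (h : S.costableRel f g) :
    S.costableRel (r • f) (r • g) := by
  rw [costableRel_iff] at *
  intro C
  ext δ
  rw [S.push_smul, S.push_smul, h]

instance : Preadditive S.Costable :=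
  CategoryTheory.Quotient.preadditive _ fun _ _ => S.costableRel_add

instance : (CategoryTheory.Quotient.functor S.costableRel).Additive :=
  CategoryTheory.Quotient.functor_additive _ fun _ _ => S.costableRel_add

instance : Linear k S.Costable :=
  CategoryTheory.Quotient.linear k _ fun r _ _ => S.costableRel_smul r

/-- The contravariant functor `D𝔼(X, -)` from the costable category to `k`-modules. -/
noncomputable def dualExt (X : 𝒞) : S.Costableᵒᵖ ⥤ ModuleCat.{v} k :=
  (CategoryTheory.Quotient.lift S.costableRel (S.E.obj (op X) ⋙ (dualFunctor k).rightOp) (by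
    intro Y Z f g h
    have h' : (S.E.obj (op X)).map f = (S.E.obj (op X)).map g :=
      ModuleCat.hom_ext ((S.costableRel_iff f g).1 h X)
    simp [h'])).leftOp

/-- `𝒞_r` consists of the objects `X` such that `D𝔼(X, -)` is a representable functor
on the costable category. -/
def Cr : ObjectProperty 𝒞 := fun X =>
  ∃ X' : S.Costable, Nonempty ((linearYoneda k S.Costable).obj X' ≅ S.dualExt X)

end Extriangulated

/-! Let `δ` in 𝔼(Y, K) realize `α`; then `g` factors through `α` iff `g^⋆ δ = 0`
(`factorsThrough_iff`). A projective summand of `C` imposes no condition, so its complement is still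
a determiner, and minimality with Krull–Schmidt cancellation makes it zero. For `C ∈ 𝒞_r`, let `Z i`
be an indecomposable summand. Without it determination fails, so some nonzero `θ = f^⋆ δ` in 𝔼(Z i,
K) has `f` passing the tests from all other summands. Choosing `θ` with minimal orbit under End(Z
i), the determiner property makes `θ` vanish along every non-retraction
(`exists_isAlmostVanishing`). A nonzero component of `θ` lives over some `A` with local endomorphism
ring. A linear form `φ` nonzero on it makes `(f, ε) ↦ φ (f_⋆ ε)` nondegenerate modulo injective
morphisms (`IsAlmostVanishing.hasDual`). Counting lengths, the pairing is perfect, which is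
representability (`HasDual.cr`), after summing over the `Z i`. -/

/-! ### Matlis-type duality: perfect pairings from length counts. -/

section Hull

variable {k : Type v} [CommRing k]

theorem mem_ringJacobson_iff {a : k} :
    a ∈ Ring.jacobson k ↔ ∀ m : Ideal k, m.IsMaximal → a ∈ m := by
  rw [Ring.jacobson_eq_sInf_isMaximal, Ideal.mem_sInf]
  exact Iff.rfl

/-- Since `k ⧸ rad k` is reduced, a representative of `a` lying in `m` would have square in the
radical, forcing `a = 0`; hence it is invertible modulo `m`. -/
theorem exists_smul_eq_of_quotient_jacobson {m : Ideal k} (hm : m.IsMaximal)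
    {a b : k ⧸ Ring.jacobson k} (ha : ∀ r ∈ m, r • a = 0) (hb : ∀ r ∈ m, r • b = 0)
    (h : a ≠ 0) : ∃ r : k, b = r • a := by
  obtain ⟨a, rfl⟩ := Submodule.Quotient.mk_surjective _ a
  obtain ⟨b, rfl⟩ := Submodule.Quotient.mk_surjective _ b
  simp only [← Submodule.Quotient.mk_smul, Submodule.Quotient.mk_eq_zero, ne_eq, smul_eq_mul]
    at ha hb h ⊢
  have ham : a ∉ m := fun h1 => h <| mem_ringJacobson_iff.2 fun n hn =>
    (hn.isPrime.mem_or_mem (mem_ringJacobson_iff.1 (ha a h1) n hn)).elim id id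
  obtain ⟨r, hr⟩ := hm.exists_inv ham
  refine ⟨r * b, (Submodule.Quotient.eq _).2 ?_⟩
  obtain ⟨μ, hμ, hr⟩ := hr
  have : b - r * b * a = μ * b := by linear_combination (-b) * hr
  rw [this]
  exact hb μ hμ

namespace IsInjectiveHull

/-- A nonzero `x` spans a copy of the simple module `k ⧸ m`, and an essential submodule contains
every simple one. -/
theorem mem_range_of_smul_eq_zero {M I : Type v} [AddCommGroup M] [Module k M]
    [AddCommGroup I] [Module k I] {i : M →ₗ[k] I}
    (hi : ∀ N : Submodule k I, N ⊓ LinearMap.range i = ⊥ → N = ⊥)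
    {m : Ideal k} (hm : m.IsMaximal) {x : I} (hx : ∀ r ∈ m, r • x = 0) :
    x ∈ LinearMap.range i := by
  by_cases h0 : x = 0
  · rw [h0]; exact Submodule.zero_mem _
  have h1 : k ∙ x ⊓ LinearMap.range i ≠ ⊥ := fun h =>
    h0 (Submodule.span_singleton_eq_bot.1 (hi _ h))
  obtain ⟨y, ⟨hy1, hy2⟩, hy⟩ := Submodule.exists_mem_ne_zero_of_ne_bot h1
  obtain ⟨r, rfl⟩ := Submodule.mem_span_singleton.1 hy1
  have hr : r ∉ m := fun h => hy (hx r h)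
  obtain ⟨s, μ, hμ, hs⟩ := hm.exists_inv hr
  have : x = s • r • x := by
    rw [smul_smul, eq_sub_of_add_eq hs, sub_smul, hx μ hμ, one_smul, sub_zero]
  rw [this]
  exact Submodule.smul_mem _ _ hy2

variable {I : Type v} [AddCommGroup I] [Module k I]

theorem exists_smul_eq (hI : IsInjectiveHull k (k ⧸ Ring.jacobson k) I)
    {m : Ideal k} (hm : m.IsMaximal) {x y : I} (hx : ∀ r ∈ m, r • x = 0)
    (hy : ∀ r ∈ m, r • y = 0) (h : x ≠ 0) : ∃ r : k, y = r • x := by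
  obtain ⟨-, i, hinj, hi⟩ := hI
  obtain ⟨a, rfl⟩ := mem_range_of_smul_eq_zero hi hm hx
  obtain ⟨b, rfl⟩ := mem_range_of_smul_eq_zero hi hm hy
  obtain ⟨r, rfl⟩ := exists_smul_eq_of_quotient_jacobson hm (a := a) (b := b)
    (fun r hr => hinj (by rw [map_smul, hx r hr, map_zero]))
    (fun r hr => hinj (by rw [map_smul, hy r hr, map_zero])) (by rintro rfl; simp at h)
  exact ⟨r, by rw [map_smul]⟩

/-- A map from `M ≅ k ⧸ m` is determined by the image of a generator `t`, which lies in the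
`m`-socle of `I`; any nonzero element generates that socle. -/
theorem length_hom_le_one (hI : IsInjectiveHull k (k ⧸ Ring.jacobson k) I)
    (M : Type v) [AddCommGroup M] [Module k M] [IsSimpleModule k M] :
    Module.length k (M →ₗ[k] I) ≤ 1 := by
  obtain ⟨m, hm, ⟨e⟩⟩ := isSimpleModule_iff_quot_maximal.1 (inferInstance : IsSimpleModule k M)
  let t : M := e.symm (Submodule.Quotient.mk 1)
  have ht : ∀ x : M, ∃ r : k, x = r • t := fun x => by
    obtain ⟨r, hr⟩ := Submodule.Quotient.mk_surjective _ (e x)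
    refine ⟨r, e.injective ?_⟩
    rw [map_smul, e.apply_symm_apply, ← hr, ← Submodule.Quotient.mk_smul, smul_eq_mul, mul_one]
  have hmt : ∀ r ∈ m, r • t = 0 := fun r hr => e.injective <| by
    rw [map_smul, e.apply_symm_apply, map_zero, ← Submodule.Quotient.mk_smul,
      Submodule.Quotient.mk_eq_zero]
    simpa using hr
  rcases subsingleton_or_nontrivial (M →ₗ[k] I) with h | h
  · simp
  · have : IsSimpleModule k (M →ₗ[k] I) := by
      rw [isSimpleModule_iff_toSpanSingleton_surjective]
      refine ⟨h, fun f hf g => ?_⟩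
      have hft : f t ≠ 0 := fun h => hf <| LinearMap.ext fun x => by
        obtain ⟨r, rfl⟩ := ht x
        rw [map_smul, h, smul_zero, LinearMap.zero_apply]
      obtain ⟨r, hr⟩ := hI.exists_smul_eq hm (x := f t) (y := g t)
        (fun r hr => by rw [← map_smul, hmt r hr, map_zero])
        (fun r hr => by rw [← map_smul, hmt r hr, map_zero]) hft
      refine ⟨r, LinearMap.ext fun x => ?_⟩
      obtain ⟨s, rfl⟩ := ht x
      simp [hr]
    rw [Module.length_eq_one]

theorem length_hom_le (hI : IsInjectiveHull k (k ⧸ Ring.jacobson k) I)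
    {M : Type v} [AddCommGroup M] [Module k M] (hM : IsFiniteLength k M) :
    Module.length k (M →ₗ[k] I) ≤ Module.length k M := by
  induction hM with
  | of_subsingleton => simp
  | @of_simple_quotient M _ _ N _ _ ih =>
    have h1 : Module.length k (M →ₗ[k] I) ≤
        Module.length k ((M ⧸ N) →ₗ[k] I) + Module.length k (N →ₗ[k] I) := by
      let f : ((M ⧸ N) →ₗ[k] I) →ₗ[k] (M →ₗ[k] I) := LinearMap.lcomp k I N.mkQ
      let g : (M →ₗ[k] I) →ₗ[k] (N →ₗ[k] I) := LinearMap.lcomp k I N.subtype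
      -- Left exactness of Hom suffices for an upper bound: the restriction map is replaced by its
      -- corestriction to its range.
      rw [Module.length_eq_add_of_exact f g.rangeRestrict ?_ g.surjective_rangeRestrict ?_]
      · gcongr
        exact Module.length_le_of_injective _ (Submodule.injective_subtype _)
      · intro a b hab
        refine LinearMap.ext fun x => ?_
        obtain ⟨x, rfl⟩ := N.mkQ_surjective x
        exact DFunLike.congr_fun hab x
      · intro a
        constructor
        · intro h
          have h' : g a = 0 := congrArg Subtype.val h
          exact ⟨N.liftQ a fun x hx => DFunLike.congr_fun h' (⟨x, hx⟩ : N), by ext; rfl⟩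
        · rintro ⟨b, rfl⟩
          refine Subtype.ext (LinearMap.ext fun x => ?_)
          have : N.mkQ x = 0 := by simp
          change b (N.mkQ x) = 0
          rw [this, map_zero]
    refine h1.trans ?_
    rw [Module.length_eq_add_of_exact N.subtype N.mkQ N.injective_subtype N.mkQ_surjective
      (LinearMap.exact_subtype_mkQ N), Module.length_eq_one k (M ⧸ N), add_comm]
    exact add_le_add ih (hI.length_hom_le_one _)

theorem exists_hom_apply_ne_zero [IsArtinianRing k]
    (hI : IsInjectiveHull k (k ⧸ Ring.jacobson k) I)
    {M : Type v} [AddCommGroup M] [Module k M] {x : M} (hx : x ≠ 0) :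
    ∃ φ : M →ₗ[k] I, φ x ≠ 0 := by
  obtain ⟨hinj, i, hi, -⟩ := hI
  let p : k →ₗ[k] M := LinearMap.toSpanSingleton k M x
  have hp : LinearMap.ker p ≠ ⊤ := fun h => hx <| by
    have : (1 : k) ∈ LinearMap.ker p := h ▸ Submodule.mem_top
    simpa [p] using this
  obtain ⟨m, hm, hpm⟩ := Ideal.exists_le_maximal (LinearMap.ker p) hp
  have hfin : {n : Ideal k | n.IsMaximal ∧ n ≠ m}.Finite :=
    (IsArtinianRing.setOfPred_isMaximal_finite k).subset fun n hn => hn.1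
  have hnle : ¬ hfin.toFinset.inf id ≤ m := fun h => by
    obtain ⟨n, hn, hnm⟩ := (Ideal.IsPrime.inf_le' hm.isPrime).1 h
    rw [Set.Finite.mem_toFinset] at hn
    exact hn.2 (hn.1.eq_of_le hm.ne_top hnm)
  -- As `a` lies in every maximal ideal except `m`, its class in `k ⧸ rad k` spans a copy of `k ⧸
  -- m`. So `k ∙ x` maps nontrivially to `I`, and injectivity extends the map to `M`.
  obtain ⟨a, ha, ham⟩ := SetLike.not_le_iff_exists.1 hnle
  let c : I := i (Submodule.Quotient.mk a)
  have hc : c ≠ 0 := fun h => ham <| mem_ringJacobson_iff.1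
    ((Submodule.Quotient.mk_eq_zero _).1 ((map_eq_zero_iff i hi).1 h)) m hm
  have hmc : ∀ r ∈ m, r • c = 0 := fun r hr => by
    have : r • a ∈ Ring.jacobson k := mem_ringJacobson_iff.2 fun n hn => by
      by_cases h : n = m
      · exact h ▸ m.mul_mem_right a hr
      · refine n.mul_mem_left r ?_
        have h2 : hfin.toFinset.inf id ≤ n :=
          Finset.inf_le (f := id) ((Set.Finite.mem_toFinset _).2 ⟨hn, h⟩)
        exact h2 ha
    rw [← map_smul, ← Submodule.Quotient.mk_smul, (Submodule.Quotient.mk_eq_zero _).2 this,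
      map_zero]
  obtain ⟨φ, hφ⟩ := hinj.out ((LinearMap.ker p).liftQ p le_rfl)
    (LinearMap.ker_eq_bot.1 (Submodule.ker_liftQ_eq_bot' _ _ rfl))
    ((LinearMap.ker p).liftQ (LinearMap.toSpanSingleton k I c) fun r hr => by
      simpa using hmc r (hpm hr))
  refine ⟨φ, ?_⟩
  have := hφ (Submodule.Quotient.mk 1)
  simp only [Submodule.liftQ_apply, p, LinearMap.toSpanSingleton_apply, one_smul] at this
  rwa [this]

/-- A pairing of `k`-modules with values in the minimal injective cogenerator, one side of which
has finite length, is perfect as soon as it is nondegenerate on both sides. -/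
theorem surjective_of_nondegenerate (hI : IsInjectiveHull k (k ⧸ Ring.jacobson k) I)
    {H M : Type v} [AddCommGroup H] [Module k H] [AddCommGroup M] [Module k M]
    (hM : IsFiniteLength k M) (p : H →ₗ[k] M →ₗ[k] I) (hl : Function.Injective p)
    (hr : Function.Injective p.flip) : Function.Surjective p := by
  have h1 := Module.length_le_of_injective p hl
  have h2 := hI.length_hom_le hM
  have h3 := Module.length_le_of_injective p.flip hr
  have hMtop := Module.length_ne_top_iff.2 hM
  have h4 := hI.length_hom_le (M := H)
    (Module.length_ne_top_iff.1 (ne_top_of_le_ne_top hMtop (h1.trans h2)))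
  have hfl : IsFiniteLength k (M →ₗ[k] I) :=
    Module.length_ne_top_iff.1 (ne_top_of_le_ne_top hMtop h2)
  obtain ⟨_, _⟩ := isFiniteLength_iff_isNoetherian_isArtinian.1 hfl
  rw [← LinearMap.range_eq_top]
  by_contra h
  -- A proper range would give ℓ(H) < ℓ(Hom(M, I)) ≤ ℓ(M) ≤ ℓ(Hom(H, I)) ≤ ℓ(H).
  have h5 := Submodule.length_lt h
  rw [← (LinearEquiv.ofInjective p hl).length_eq] at h5
  exact absurd (h2.trans (h3.trans h4)) (not_le.2 h5)

end IsInjectiveHull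

theorem minInjCogen_isInjectiveHull (k : Type v) [CommRing k] :
    IsInjectiveHull k (k ⧸ Ring.jacobson k) (minInjCogen k) :=
  (exists_isInjectiveHull k (k ⧸ Ring.jacobson k)).choose_spec

end Hull
open scoped ZeroObject

attribute [local instance] hasBinaryBiproducts_of_finite_biproducts

/-! ### Cancellation in Krull–Schmidt categories. -/

section KrullSchmidt

variable {𝒞 : Type u} [Category.{v} 𝒞]

/-- The element `b * a` is idempotent, and in a local ring it or its complement is a unit, so it is
`1` or `0`; the latter contradicts `a * b = 1`. -/
theorem IsLocalRing.mul_eq_one_symm {R : Type*} [Ring R] [IsLocalRing R] {a b : R}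
    (h : a * b = 1) : b * a = 1 := by
  have hi : IsUnit (b * a) ∨ IsUnit (1 - b * a) :=
    IsLocalRing.isUnit_or_isUnit_of_add_one (by abel)
  have hss : b * a * (b * a) = b * a := by
    rw [mul_assoc, ← mul_assoc a b a, h, one_mul]
  rcases hi with hi | hi
  · exact hi.mul_left_cancel (by rw [hss, mul_one])
  · have h3 : b * a = 0 := hi.mul_left_cancel (by rw [sub_mul, one_mul, hss, sub_self, mul_zero])
    have h4 : (1 : R) = 0 := by
      calc (1 : R) = a * (b * a) * b := by rw [mul_assoc, mul_assoc, h, mul_one, h]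
        _ = 0 := by rw [h3, mul_zero, zero_mul]
    exact absurd h4 one_ne_zero

theorem isIso_of_comp_eq_id [Preadditive 𝒞] {L : 𝒞} [IsLocalRing (End L)] {s f : L ⟶ L}
    (h : s ≫ f = 𝟙 L) : IsIso f ∧ IsIso s := by
  have h2 : f ≫ s = 𝟙 L :=
    IsLocalRing.mul_eq_one_symm (R := End L) (a := End.of f) (b := End.of s) h
  exact ⟨⟨s, h2, h⟩, ⟨f, h, h2⟩⟩

theorem isIso_or_isIso_of_add_eq_id [Preadditive 𝒞] {L : 𝒞} [IsLocalRing (End L)] {f g : L ⟶ L}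
    (h : f + g = 𝟙 L) : IsIso f ∨ IsIso g := by
  have h' : End.of f + End.of g = 1 := h
  exact (IsLocalRing.isUnit_or_isUnit_of_add_one h').imp
    (isUnit_iff_isIso f).1 (isUnit_iff_isIso g).1

theorem not_isZero_of_isLocalRing_end [Preadditive 𝒞] {L : 𝒞} [IsLocalRing (End L)] :
    ¬ IsZero L := fun h => one_ne_zero (α := End L) (h.eq_of_src _ _)

theorem FactorsThrough.comp_left {X Y T T' : 𝒞} {g : T ⟶ Y} {f : X ⟶ Y}
    (h : FactorsThrough g f) (t : T' ⟶ T) : FactorsThrough (t ≫ g) f := by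
  obtain ⟨s, rfl⟩ := h
  exact ⟨t ≫ s, by simp⟩

variable [Preadditive 𝒞] [HasFiniteBiproducts 𝒞]

/-- If the component `f : L ⟶ L` of `e` is invertible, Gaussian elimination applies. Otherwise the
`L`-entry of `e ≫ e⁻¹` reads `f ≫ t + w = 𝟙`, where `w` passes through `B`. Locality makes `w`,
hence `f + w`, invertible, and a shear of the target replaces `f` by `f + w`. -/
theorem nonempty_iso_of_biprod_iso {L A B : 𝒞} [IsLocalRing (End L)] (e : L ⊞ A ≅ L ⊞ B) :
    Nonempty (A ≅ B) := by
  have key : biprod.inl ≫ e.hom ≫ biprod.fst ≫ biprod.inl ≫ e.inv ≫ biprod.fst +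
      biprod.inl ≫ e.hom ≫ biprod.snd ≫ biprod.inr ≫ e.inv ≫ biprod.fst = 𝟙 L := by
    have h := congrArg (fun t => biprod.inl ≫ e.hom ≫ t ≫ e.inv ≫ biprod.fst)
      (biprod.total (X := L) (Y := B))
    simp only [Preadditive.add_comp, Preadditive.comp_add, Category.assoc, Category.id_comp,
      e.hom_inv_id_assoc, biprod.inl_fst] at h
    exact h
  by_cases h : IsIso (biprod.inl ≫ e.hom ≫ biprod.fst : L ⟶ L)
  · exact ⟨Biprod.isoElim e⟩
  · let s : B ⟶ L := biprod.inr ≫ e.inv ≫ biprod.fst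
    let f : L ⟶ L := biprod.inl ≫ e.hom ≫ biprod.fst
    let t : L ⟶ L := biprod.inl ≫ e.inv ≫ biprod.fst
    let w : L ⟶ L := (biprod.inl ≫ e.hom ≫ biprod.snd) ≫ s
    have hw : IsIso w := by
      refine (isIso_or_isIso_of_add_eq_id (f := f ≫ t) (g := w)
        (by simpa [f, t, w, s] using key)).resolve_left fun h1 => h ?_
      exact (isIso_of_comp_eq_id (s := f) (f := t ≫ inv (f ≫ t))
        (by rw [← Category.assoc, IsIso.hom_inv_id])).2
    have hfw : IsIso (f + w) := by
      have h2 : (f + w) ≫ inv w + (-f) ≫ inv w = 𝟙 L := by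
        rw [← Preadditive.add_comp, add_neg_cancel_comm, IsIso.hom_inv_id]
      rcases isIso_or_isIso_of_add_eq_id h2 with h3 | h3
      · exact IsIso.of_isIso_comp_right _ (inv w)
      · have h4 : IsIso (-f) := IsIso.of_isIso_comp_right _ (inv w)
        refine absurd (⟨-inv (-f), ?_, ?_⟩ : IsIso f) h
        · rw [Preadditive.comp_neg, ← Preadditive.neg_comp, IsIso.hom_inv_id]
        · rw [Preadditive.neg_comp, ← Preadditive.comp_neg, IsIso.inv_hom_id]
    let e' : L ⊞ A ≅ L ⊞ B := e ≪≫ Biprod.unipotentLower s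
    have : IsIso (biprod.inl ≫ e'.hom ≫ biprod.fst : L ⟶ L) := by
      have : (biprod.inl ≫ e'.hom ≫ biprod.fst : L ⟶ L) = f + w := by
        simp [e', f, w, s, Biprod.unipotentLower, Biprod.ofComponents]
      rw [this]
      exact hfw
    exact ⟨Biprod.isoElim e'⟩

/-- A finite biproduct splits off any of its summands. -/
noncomputable def biproductIsoBiprodSubtype {J : Type} [Finite J] (Z : J → 𝒞) (i : J) :
    ⨁ Z ≅ Z i ⊞ ⨁ (fun j : {j // j ≠ i} => Z j) where
  hom := biprod.lift (biproduct.π Z i) (biproduct.lift fun j => biproduct.π Z j)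
  inv := biprod.desc (biproduct.ι Z i) (biproduct.desc fun j => biproduct.ι Z j)
  hom_inv_id := by
    classical
    rw [biprod.lift_desc]
    refine biproduct.hom_ext' _ _ fun j => ?_
    rw [Preadditive.comp_add, Category.comp_id]
    by_cases h : j = i
    · subst h
      have : biproduct.ι Z j ≫ biproduct.lift (fun l : {l // l ≠ j} => biproduct.π Z l) = 0 :=
        biproduct.hom_ext _ _ fun l => by simp [biproduct.ι_π_ne _ l.2.symm]
      rw [reassoc_of% this]
      simp
    · have : biproduct.ι Z j ≫ biproduct.lift (fun l : {l // l ≠ i} => biproduct.π Z l) =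
          biproduct.ι (fun l : {l // l ≠ i} => Z l) ⟨j, h⟩ :=
        biproduct.hom_ext _ _ fun l => by
          rw [Category.assoc, biproduct.lift_π]
          by_cases hl : j = l
          · subst hl
            simp
          · rw [biproduct.ι_π_ne _ hl, biproduct.ι_π_ne]
            rintro rfl
            exact hl rfl
      rw [reassoc_of% this, biproduct.ι_π_ne_assoc _ h]
      simp
  inv_hom_id := by
    classical
    refine biprod.hom_ext' _ _ (biprod.hom_ext _ _ ?_ (biproduct.hom_ext _ _ fun l => ?_))
      (biproduct.hom_ext' _ _ fun j => biprod.hom_ext _ _ ?_ (biproduct.hom_ext _ _ fun l => ?_))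
    · simp
    · simp [biproduct.ι_π_ne _ l.2.symm]
    · simp [biproduct.ι_π_ne _ j.2]
    · simp only [biprod.inr_desc_assoc, biproduct.ι_desc_assoc, Category.assoc,
        biprod.lift_snd, biproduct.lift_π, Category.comp_id,
        biprod.inr_snd_assoc]
      by_cases hl : j = l
      · subst hl
        simp
      · rw [biproduct.ι_π_ne _ hl, biproduct.ι_π_ne]
        exact fun h => hl (Subtype.ext h)

/-- The index type varies in the induction, since removing a summand leaves a subtype. -/
theorem nonempty_iso_of_biproduct_biprod_iso (n : ℕ) {J : Type} [Finite J] (hJ : Nat.card J = n)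
    (Z : J → 𝒞) (hZ : ∀ j, IsLocalRing (End (Z j))) {A B : 𝒞} (e : (⨁ Z) ⊞ A ≅ (⨁ Z) ⊞ B) :
    Nonempty (A ≅ B) := by
  induction n generalizing J A B with
  | zero =>
    have : IsEmpty J := (Nat.card_eq_zero.1 hJ).resolve_right fun h => not_finite J
    have h0 : IsZero (⨁ Z) := (IsZero.iff_id_eq_zero _).2
      (biproduct.hom_ext _ _ fun j => isEmptyElim j)
    exact ⟨(isoZeroBiprod h0) ≪≫ e ≪≫ (isoZeroBiprod h0).symm⟩
  | succ n ih =>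
    have : Nonempty J := (Nat.card_pos_iff.1 (by omega)).1
    obtain ⟨i⟩ := this
    have := hZ i
    let a := biproductIsoBiprodSubtype Z i
    obtain ⟨e'⟩ := nonempty_iso_of_biprod_iso ((biprod.associator _ _ A).symm ≪≫
      (biprod.mapIso a (Iso.refl A)).symm ≪≫ e ≪≫ biprod.mapIso a (Iso.refl B) ≪≫
      biprod.associator _ _ B)
    refine ih (J := {j // j ≠ i}) ?_ (fun j => Z j) (fun j => hZ j) e'
    have := Fintype.ofFinite J
    classical
    rw [Nat.card_eq_fintype_card] at hJ ⊢
    rw [Fintype.card_subtype_compl, Fintype.card_subtype_eq, hJ]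
    rfl

theorem IsKrullSchmidt.isZero_of_iso_biprod (hKS : IsKrullSchmidt 𝒞) {Z V : 𝒞}
    (e : Z ≅ Z ⊞ V) : IsZero V := by
  obtain ⟨n, W, hW, ⟨a⟩⟩ := hKS Z
  have : HasZeroObject 𝒞 := hasZeroObject_of_hasFiniteBiproducts 𝒞
  have h0 : IsZero (0 : 𝒞) := isZero_zero 𝒞
  obtain ⟨e'⟩ := nonempty_iso_of_biproduct_biprod_iso n (by simp) W hW
    ((isoBiprodZero h0).symm ≪≫ a.symm ≪≫ e ≪≫ biprod.mapIso a (Iso.refl V))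
  exact h0.of_iso e'.symm

/-- If `C ≅ P ⊞ Z` is a direct summand of `Z` in a Krull–Schmidt category, then `P = 0`. -/
theorem IsKrullSchmidt.isZero_of_isDirectSummand (hKS : IsKrullSchmidt 𝒞) {C P Z : 𝒞}
    (e : C ≅ P ⊞ Z) (h : IsDirectSummand C Z) : IsZero P := by
  obtain ⟨W, ⟨f⟩⟩ := h
  have h1 : IsZero (P ⊞ W) := hKS.isZero_of_iso_biprod (Z := Z)
    (f ≪≫ biprod.mapIso (e ≪≫ biprod.braiding _ _) (Iso.refl W) ≪≫ biprod.associator _ _ _)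
  exact ((biprod_isZero_iff P W).1 h1).1

theorem factorsThrough_biproduct {J : Type} [Finite J] {Z : J → 𝒞} {X Y : 𝒞} {g : ⨁ Z ⟶ Y}
    {f : X ⟶ Y} (h : ∀ j, FactorsThrough (biproduct.ι Z j ≫ g) f) : FactorsThrough g f := by
  choose t ht using h
  exact ⟨biproduct.desc t, by ext j; simp [ht]⟩

end KrullSchmidt

/-! ### Exact sequences attached to a realized extension. -/

namespace Extriangulated

variable {k : Type v} [CommRing k] {𝒞 : Type u} [Category.{v} 𝒞]
  [Preadditive 𝒞] [Linear k 𝒞] [HasFiniteBiproducts 𝒞] (S : Extriangulated k 𝒞)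

theorem pull_comp (A : 𝒞) {X Y Z : 𝒞} (f : X ⟶ Y) (g : Y ⟶ Z) (δ : ExtOf S.E Z A) :
    pull S.E A (f ≫ g) δ = pull S.E A f (pull S.E A g δ) := by
  simp [pull]

theorem push_comp_apply (C : 𝒞) {X Y Z : 𝒞} (f : X ⟶ Y) (g : Y ⟶ Z) (δ : ExtOf S.E C X) :
    push S.E C (f ≫ g) δ = push S.E C g (push S.E C f δ) := by
  rw [S.push_comp]; rfl

theorem pull_id (A C : 𝒞) (δ : ExtOf S.E C A) : pull S.E A (𝟙 C) δ = δ := by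
  simp [pull]

theorem push_id (A C : 𝒞) (δ : ExtOf S.E C A) : push S.E C (𝟙 A) δ = δ := by
  simp [push]

theorem push_pull {A A' C C' : 𝒞} (a : A ⟶ A') (c : C' ⟶ C) (δ : ExtOf S.E C A) :
    push S.E C' a (pull S.E A c δ) = pull S.E A' c (push S.E C a δ) :=
  (DFunLike.congr_fun (congrArg ModuleCat.Hom.hom ((S.E.map c.op).naturality a)) δ).symm

theorem exists_realization {A C : 𝒞} (δ : ExtOf S.E C A) :
    ∃ (B : 𝒞) (x : A ⟶ B) (y : B ⟶ C), S.s δ = seqClass x y := by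
  obtain ⟨⟨B, x, y⟩, h⟩ := Quotient.exists_rep (S.s δ)
  exact ⟨B, x, y, h.symm⟩

/-- `f ↦ f^⋆ δ` as a linear map. -/
def pullLinear {A C : 𝒞} (C' : 𝒞) (δ : ExtOf S.E C A) : (C' ⟶ C) →ₗ[k] ExtOf S.E C' A where
  toFun f := pull S.E A f δ
  map_add' f g := S.pull_add f g δ
  map_smul' r f := S.pull_smul r f δ

/-- `f ↦ f_⋆ δ` as a linear map. -/
def pushLinear {A C : 𝒞} (A' : 𝒞) (δ : ExtOf S.E C A) : (A ⟶ A') →ₗ[k] ExtOf S.E C A' where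
  toFun f := push S.E C f δ
  map_add' f g := S.push_add f g δ
  map_smul' r f := S.push_smul r f δ

variable {S}

/-- Compare with the split sequence realizing `0`: a factorization is a morphism of sequences out of
it, and conversely. -/
theorem factorsThrough_iff {A B C T : 𝒞} {x : A ⟶ B} {y : B ⟶ C} {δ : ExtOf S.E C A}
    (h : S.s δ = seqClass x y) (g : T ⟶ C) : FactorsThrough g y ↔ pull S.E A g δ = 0 := by
  constructor
  · rintro ⟨t, rfl⟩
    obtain ⟨a, -, h2⟩ := S.et3_op (S.s_zero A T) h (biprod.snd ≫ t) (t ≫ y) (by simp)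
    rw [← h2, map_zero]
  · intro hg
    obtain ⟨b, -, h2⟩ := S.realization (S.s_zero A T) h (𝟙 A) g (by rw [hg, map_zero])
    exact ⟨biprod.inr ≫ b, by rw [Category.assoc, ← h2]; simp⟩

theorem push_eq_zero_iff {A B C T : 𝒞} {x : A ⟶ B} {y : B ⟶ C} {δ : ExtOf S.E C A}
    (h : S.s δ = seqClass x y) (a : A ⟶ T) :
    push S.E C a δ = 0 ↔ ∃ b : B ⟶ T, x ≫ b = a := by
  constructor
  · intro ha
    obtain ⟨b, h1, -⟩ := S.realization h (S.s_zero T C) a (𝟙 C) (by rw [ha, map_zero])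
    exact ⟨b ≫ biprod.fst, by rw [← Category.assoc, h1]; simp⟩
  · rintro ⟨b, rfl⟩
    obtain ⟨c, -, h2⟩ := S.et3 h (S.s_zero T C) (x ≫ b) (b ≫ biprod.inl) (by simp)
    rw [h2, map_zero]

/-- Exactness of `𝒞(C', C) ⟶ 𝔼(C', A) ⟶ 𝔼(C', B)`. -/
theorem exists_pull_eq {A B C C' : 𝒞} {x : A ⟶ B} {y : B ⟶ C} {δ : ExtOf S.E C A}
    (h : S.s δ = seqClass x y) {θ : ExtOf S.E C' A} (hθ : push S.E C' x θ = 0) :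
    ∃ c : C' ⟶ C, pull S.E A c δ = θ := by
  obtain ⟨F, u, w, hu⟩ := S.exists_realization θ
  obtain ⟨b, hb⟩ := (push_eq_zero_iff hu x).1 hθ
  obtain ⟨c, -, hc⟩ := S.et3 hu h (𝟙 A) b (by simpa using hb)
  exact ⟨c, by rw [← hc, push_id]⟩

/-- Exactness of `𝒞(A, A') ⟶ 𝔼(C, A') ⟶ 𝔼(B, A')`. -/
theorem exists_push_eq {A A' B C : 𝒞} {x : A ⟶ B} {y : B ⟶ C} {δ : ExtOf S.E C A}
    (h : S.s δ = seqClass x y) {θ : ExtOf S.E C A'} (hθ : pull S.E A' y θ = 0) :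
    ∃ a : A ⟶ A', push S.E C a δ = θ := by
  obtain ⟨F, u, w, hu⟩ := S.exists_realization θ
  obtain ⟨b, hb⟩ := (factorsThrough_iff hu y).2 hθ
  obtain ⟨a, -, ha⟩ := S.et3_op h hu b (𝟙 C) (by simpa using hb.symm)
  exact ⟨a, by rw [ha, pull_id]⟩

/-! ### Almost vanishing extensions and the pairings they induce. -/

variable (S)

/-- A nonzero extension all of whose pullbacks along morphisms other than retractions vanish. -/
structure IsAlmostVanishing {A C : 𝒞} (θ : ExtOf S.E C A) : Prop where
  ne_zero : θ ≠ 0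
  pull_eq_zero : ∀ {T : 𝒞} (r : T ⟶ C), (∀ s : C ⟶ T, s ≫ r ≠ 𝟙 C) → pull S.E A r θ = 0

variable {S}

namespace IsAlmostVanishing

/-- The deflation realizing `ε ≠ 0` is not a retraction, so `θ` vanishes along it and exactness
applies. -/
theorem exists_push_eq {A A' C : 𝒞} {θ : ExtOf S.E C A} (hθ : S.IsAlmostVanishing θ)
    {ε : ExtOf S.E C A'} (hε : ε ≠ 0) : ∃ f : A' ⟶ A, push S.E C f ε = θ := by
  obtain ⟨G, u, g, hg⟩ := S.exists_realization ε
  refine Extriangulated.exists_push_eq hg (hθ.pull_eq_zero g fun s hs => hε ?_)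
  rw [← pull_id S A' C ε]
  exact (factorsThrough_iff hg _).1 ⟨s, hs⟩

/-- The dual vanishing property is automatic. If `a_⋆ θ ≠ 0`, some `f` pushes it back to `θ`, so `𝟙
- a ≫ f` kills `θ` and is not invertible; by locality `a ≫ f` is, and `a` is a section. -/
theorem push_eq_zero {A A' C : 𝒞} [IsLocalRing (End A)] {θ : ExtOf S.E C A}
    (hθ : S.IsAlmostVanishing θ) (a : A ⟶ A') (ha : ∀ r : A' ⟶ A, a ≫ r ≠ 𝟙 A) :
    push S.E C a θ = 0 := by
  by_contra h
  obtain ⟨f, hf⟩ := hθ.exists_push_eq h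
  rw [← push_comp_apply] at hf
  rcases isIso_or_isIso_of_add_eq_id (f := a ≫ f) (g := 𝟙 A - a ≫ f) (by abel) with h1 | h1
  · exact ha (f ≫ inv (a ≫ f)) (by rw [← Category.assoc, IsIso.hom_inv_id])
  · refine hθ.ne_zero ?_
    have h2 : push S.E C (𝟙 A - a ≫ f) θ = 0 := by
      have := (S.pushLinear A θ).map_sub (𝟙 A) (a ≫ f)
      simp only [pushLinear, LinearMap.coe_mk, AddHom.coe_mk, hf, push_id, sub_self] at this
      exact this
    rw [← push_id S A C θ, ← IsIso.hom_inv_id (𝟙 A - a ≫ f), push_comp_apply, h2, map_zero]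

/-- The inflation realizing `f_⋆ ε ≠ 0` is not a section, so it kills `θ`; hence `θ = c^⋆ f_⋆ ε =
f_⋆ (c^⋆ ε)` for some `c`. -/
theorem exists_push_pull_eq {A A' B C : 𝒞} [IsLocalRing (End A)] {θ : ExtOf S.E C A}
    (hθ : S.IsAlmostVanishing θ) (f : A' ⟶ A) {ε : ExtOf S.E B A'} (h : push S.E B f ε ≠ 0) :
    ∃ η : ExtOf S.E C A', push S.E C f η = θ := by
  obtain ⟨F, j, q, hj⟩ := S.exists_realization (push S.E B f ε)
  obtain ⟨c, hc⟩ := exists_pull_eq hj (hθ.push_eq_zero j fun r hr => h (by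
    rw [← push_id S A B (push S.E B f ε)]
    exact (push_eq_zero_iff hj _).2 ⟨r, hr⟩))
  exact ⟨pull S.E A' c ε, by rw [push_pull, hc]⟩

end IsAlmostVanishing

variable (S)

/-- There is an object `A` and a linear form on `𝔼(C, A)` such that the induced pairings of
`𝒞(B, A)` modulo injective morphisms with `𝔼(C, B)` are nondegenerate. -/
def HasDual (C : 𝒞) : Prop :=
  ∃ (A : 𝒞) (φ : ExtOf S.E C A →ₗ[k] minInjCogen k),
    (∀ {B : 𝒞} (f : B ⟶ A), (∀ ε, φ (push S.E C f ε) = 0) → S.IsInjectiveMor f) ∧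
    ∀ {B : 𝒞} (ε : ExtOf S.E C B), (∀ f : B ⟶ A, φ (push S.E C f ε) = 0) → ε = 0

variable {S}

/-- Take `φ` with `φ θ ≠ 0`. Every nonzero `ε` is pushed to `θ` by some morphism, and every
non-injective `f` pushes some extension to `θ`, so neither side of the pairing degenerates. -/
theorem IsAlmostVanishing.hasDual [IsArtinianRing k] {A C : 𝒞} [IsLocalRing (End A)]
    {θ : ExtOf S.E C A} (hθ : S.IsAlmostVanishing θ) : S.HasDual C := by
  obtain ⟨φ, hφ⟩ := (minInjCogen_isInjectiveHull k).exists_hom_apply_ne_zero hθ.ne_zero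
  refine ⟨A, φ, fun f hf B => ?_, fun ε hε => ?_⟩
  · refine LinearMap.ext fun ε => by_contra fun h => hφ ?_
    obtain ⟨η, hη⟩ := hθ.exists_push_pull_eq f h
    rw [← hη, hf]
  · by_contra h
    obtain ⟨f, hf⟩ := hθ.exists_push_eq h
    exact hφ (hf ▸ hε f)

theorem HasDual.of_iso {C C' : 𝒞} (h : S.HasDual C) (e : C ≅ C') : S.HasDual C' := by
  obtain ⟨A, φ, h1, h2⟩ := h
  have hinv : ∀ {B : 𝒞} (ε : ExtOf S.E C B),
      pull S.E B e.hom (pull S.E B e.inv ε) = ε := fun ε => by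
    rw [← pull_comp, e.hom_inv_id, pull_id]
  have hinv' : ∀ {B : 𝒞} (ε : ExtOf S.E C' B),
      pull S.E B e.inv (pull S.E B e.hom ε) = ε := fun ε => by
    rw [← pull_comp, e.inv_hom_id, pull_id]
  refine ⟨A, φ ∘ₗ pull S.E A e.hom, fun f hf => h1 f fun ε => ?_, fun ε hε => ?_⟩
  · have := hf (pull S.E _ e.inv ε)
    rwa [LinearMap.comp_apply, ← push_pull, hinv] at this
  · rw [← hinv' ε, h2 (pull S.E _ e.hom ε) fun f => ?_, map_zero]
    have := hε f
    rwa [LinearMap.comp_apply, ← push_pull] at this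

theorem eq_zero_of_pull_ι_eq_zero {J : Type} [Finite J] {Z : J → 𝒞} {B : 𝒞}
    {ε : ExtOf S.E (⨁ Z) B} (h : ∀ j, pull S.E B (biproduct.ι Z j) ε = 0) : ε = 0 := by
  have := Fintype.ofFinite J
  rw [← pull_id S B _ ε, ← biproduct.total]
  change S.pullLinear (⨁ Z) ε _ = 0
  rw [map_sum]
  refine Finset.sum_eq_zero fun j _ => ?_
  change pull S.E B _ ε = 0
  rw [pull_comp, h, map_zero]

theorem eq_zero_of_push_π_eq_zero {J : Type} [Finite J] {Z : J → 𝒞} {C : 𝒞}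
    {ε : ExtOf S.E C (⨁ Z)} (h : ∀ j, push S.E C (biproduct.π Z j) ε = 0) : ε = 0 := by
  have := Fintype.ofFinite J
  rw [← push_id S _ C ε, ← biproduct.total]
  change S.pushLinear (⨁ Z) ε _ = 0
  rw [map_sum]
  refine Finset.sum_eq_zero fun j _ => ?_
  change push S.E C _ ε = 0
  rw [push_comp_apply, h, map_zero]

theorem HasDual.biproduct {J : Type} [Finite J] {Z : J → 𝒞} (h : ∀ j, S.HasDual (Z j)) :
    S.HasDual (⨁ Z) := by
  classical
  have := Fintype.ofFinite J
  choose A φ h1 h2 using h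
  -- Only diagonal components are seen, so testing against elements supported on one index recovers
  -- the single form `φ j`.
  let ψ : ExtOf S.E (⨁ Z) (⨁ A) →ₗ[k] minInjCogen k :=
    ∑ j, φ j ∘ₗ push S.E (Z j) (biproduct.π A j) ∘ₗ pull S.E (⨁ A) (biproduct.ι Z j)
  have hψ : ∀ ε, ψ ε = ∑ j, φ j (push S.E (Z j) (biproduct.π A j)
      (pull S.E (⨁ A) (biproduct.ι Z j) ε)) := fun ε => by simp [ψ]
  refine ⟨⨁ A, ψ, fun {B} f hf D => ?_, fun {B} ε hε => ?_⟩
  · refine LinearMap.ext fun ε => eq_zero_of_push_π_eq_zero fun j => ?_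
    rw [← push_comp_apply, h1 j (f ≫ biproduct.π A j) (fun η => ?_) D, LinearMap.zero_apply]
    have h3 := hf (pull S.E B (biproduct.π Z j) η)
    rw [hψ, Finset.sum_eq_single j] at h3
    · rwa [← push_pull, ← push_comp_apply, ← pull_comp, biproduct.ι_π_self, pull_id] at h3
    · intro l _ hl
      have h0 : pull S.E B (0 : Z l ⟶ Z j) η = 0 := (S.pullLinear (Z l) η).map_zero
      rw [← push_pull, ← pull_comp, biproduct.ι_π_ne _ hl, h0]
      simp
    · simp
  · refine eq_zero_of_pull_ι_eq_zero fun j => h2 j _ fun f => ?_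
    have h3 := hε (f ≫ biproduct.ι A j)
    rw [hψ, Finset.sum_eq_single j] at h3
    · rwa [← push_pull, ← push_comp_apply, Category.assoc, biproduct.ι_π_self,
        Category.comp_id] at h3
    · intro l _ hl
      have h0 : push S.E (Z l) (0 : B ⟶ A l) (pull S.E B (biproduct.ι Z l) ε) = 0 :=
        (S.pushLinear (A l) _).map_zero
      rw [← push_pull, ← push_comp_apply, Category.assoc, biproduct.ι_π_ne _ hl.symm, comp_zero, h0,
        map_zero]
    · simp

end Extriangulated


/-! ### Representability, and extensions from a minimal determiner. -/

namespace Extriangulated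

variable {k : Type v} [CommRing k] {𝒞 : Type u} [Category.{v} 𝒞]
  [Preadditive 𝒞] [Linear k 𝒞] [HasFiniteBiproducts 𝒞] {S : Extriangulated k 𝒞}

variable (S) in
/-- The linear form on `𝔼(C, B)` attached by the Yoneda lemma to a linear form on `𝔼(C, A)` and a
morphism `B ⟶ A` of the costable category. -/
noncomputable def pairing {A C : 𝒞} (φ : ExtOf S.E C A →ₗ[k] minInjCogen k) (B : 𝒞) :
    ((Quotient.functor S.costableRel).obj B ⟶ (Quotient.functor S.costableRel).obj A) →ₗ[k]
      ExtOf S.E C B →ₗ[k] minInjCogen k where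
  -- Using the action of `dualExt` makes this well defined on the quotient and turns naturality in
  -- `B` into functoriality.
  toFun f := ModuleCat.Hom.hom (((S.dualExt C).map f.op).hom (ModuleCat.ofHom φ))
  map_add' f g := by
    obtain ⟨f, rfl⟩ := (Quotient.functor S.costableRel).map_surjective f
    obtain ⟨g, rfl⟩ := (Quotient.functor S.costableRel).map_surjective g
    rw [← Functor.map_add]
    refine LinearMap.ext fun ε => ?_
    change φ (push S.E C (f + g) ε) = φ (push S.E C f ε) + φ (push S.E C g ε)
    rw [S.push_add, map_add]
  map_smul' r f := by
    obtain ⟨f, rfl⟩ := (Quotient.functor S.costableRel).map_surjective f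
    refine LinearMap.ext fun ε => ?_
    change φ (push S.E C (r • f) ε) = r • φ (push S.E C f ε)
    rw [S.push_smul, map_smul]

theorem pairing_map {A C : 𝒞} (φ : ExtOf S.E C A →ₗ[k] minInjCogen k) {B : 𝒞} (f : B ⟶ A)
    (ε : ExtOf S.E C B) :
    S.pairing φ B ((Quotient.functor S.costableRel).map f) ε = φ (push S.E C f ε) := rfl

theorem HasDual.cr [IsArtinianRing k] (hfin : S.ExtFinite) {C : 𝒞} (h : S.HasDual C) :
    S.Cr C := by
  obtain ⟨A, φ, h1, h2⟩ := h
  have hbij : ∀ B : 𝒞, Function.Bijective (S.pairing φ B) := fun B => by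
    have hl : Function.Injective (S.pairing φ B) := by
      rw [injective_iff_map_eq_zero]
      intro f hf
      obtain ⟨f, rfl⟩ := (Quotient.functor S.costableRel).map_surjective f
      have h3 : S.IsInjectiveMor f := h1 f fun ε => by rw [← pairing_map, hf]; rfl
      rw [← (Quotient.functor S.costableRel).map_zero]
      exact CategoryTheory.Quotient.sound _ (show S.IsInjectiveMor (f - 0) by rwa [sub_zero])
    have hr : Function.Injective (S.pairing φ B).flip := by
      rw [injective_iff_map_eq_zero]
      intro ε hε
      exact h2 ε fun f => DFunLike.congr_fun hε ((Quotient.functor S.costableRel).map f)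
    have := hfin C B
    have : IsArtinian k (ExtOf S.E C B) := isArtinian_of_fg_of_artinian'
    have : IsNoetherian k (ExtOf S.E C B) := inferInstance
    exact ⟨hl, (minInjCogen_isInjectiveHull k).surjective_of_nondegenerate
      (isFiniteLength_iff_isNoetherian_isArtinian.2 ⟨inferInstance, inferInstance⟩) _ hl hr⟩
  refine ⟨(Quotient.functor S.costableRel).obj A, ⟨NatIso.ofComponents (fun B =>
    (LinearEquiv.ofBijective (S.pairing φ B.unop.as) (hbij B.unop.as) ≪≫ₗ
      ModuleCat.homLinearEquiv.symm).toModuleIso) ?_⟩⟩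
  intro B B' f
  refine ModuleCat.hom_ext (LinearMap.ext fun g => ?_)
  exact DFunLike.congr_fun (congrArg ModuleCat.Hom.hom ((S.dualExt C).map_comp g.op f))
    (ModuleCat.ofHom φ)

/-- Among the nonzero elements of a set of extensions stable under endomorphisms of `L`, there is
one which is killed by all nonisomorphisms `L ⟶ L`. -/
theorem exists_pull_eq_zero_of_not_isIso [IsArtinianRing k] {L K : 𝒞} [IsLocalRing (End L)]
    [Module.Finite k (ExtOf S.E L K)] (M : Set (ExtOf S.E L K))
    (hM : ∀ θ ∈ M, ∀ r : L ⟶ L, pull S.E K r θ ∈ M) (hne : ∃ θ ∈ M, θ ≠ 0) :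
    ∃ θ ∈ M, θ ≠ 0 ∧ ∀ r : L ⟶ L, ¬ IsIso r → pull S.E K r θ = 0 := by
  have : IsArtinian k (ExtOf S.E L K) := isArtinian_of_fg_of_artinian'
  obtain ⟨θ₀, hθ₀, hθ₀'⟩ := hne
  -- Minimize the orbit `{t^⋆ θ}`. If `r^⋆ θ ≠ 0`, its orbit is the same, so `θ = (t ≫ r)^⋆ θ` for
  -- some `t`; locality then forces `r` to be invertible.
  obtain ⟨_, ⟨θ, hθ, hθ', rfl⟩, hmin⟩ := IsArtinian.set_has_minimal
    {N : Submodule k (ExtOf S.E L K) |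
      ∃ θ ∈ M, θ ≠ 0 ∧ LinearMap.range (S.pullLinear L θ) = N} ⟨_, θ₀, hθ₀, hθ₀', rfl⟩
  refine ⟨θ, hθ, hθ', fun r hr => by_contra fun h => ?_⟩
  have hle : LinearMap.range (S.pullLinear L (pull S.E K r θ)) ≤
      LinearMap.range (S.pullLinear L θ) := by
    rintro _ ⟨t, rfl⟩
    exact ⟨t ≫ r, S.pull_comp K t r θ⟩
  have heq := hle.eq_of_not_lt (hmin _ ⟨_, hM θ hθ r, h, rfl⟩)
  obtain ⟨t, ht⟩ : θ ∈ LinearMap.range (S.pullLinear L (pull S.E K r θ)) :=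
    heq ▸ ⟨𝟙 L, S.pull_id K L θ⟩
  replace ht : pull S.E K (t ≫ r) θ = θ := (S.pull_comp K t r θ).trans ht
  rcases isIso_or_isIso_of_add_eq_id (f := t ≫ r) (g := 𝟙 L - t ≫ r) (by abel) with h1 | h1
  · exact hr (isIso_of_comp_eq_id (s := inv (t ≫ r) ≫ t) (f := r)
      (by rw [Category.assoc, IsIso.inv_hom_id])).1
  · refine hθ' ?_
    have h2 : pull S.E K (𝟙 L - t ≫ r) θ = 0 := by
      refine ((S.pullLinear L θ).map_sub (𝟙 L) (t ≫ r)).trans ?_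
      change pull S.E K (𝟙 L) θ - pull S.E K (t ≫ r) θ = 0
      rw [ht, pull_id, sub_self]
    rw [← S.pull_id K L θ, ← IsIso.inv_hom_id (𝟙 L - t ≫ r), pull_comp, h2, map_zero]

/-- The indecomposable direct summands of a minimal right determiner of a deflation carry almost
vanishing extensions. -/
theorem exists_isAlmostVanishing [IsArtinianRing k] (hKS : IsKrullSchmidt 𝒞)
    (hfin : S.ExtFinite) {K X Y : 𝒞} {ι : K ⟶ X} {α : X ⟶ Y} {δ : ExtOf S.E Y K}
    (hδ : S.s δ = seqClass ι α) {C : 𝒞} (hC : IsMinimalRightDeterminer C α)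
    {J : Type} [Finite J] {Z : J → 𝒞} (e : C ≅ ⨁ Z) (i : J) [IsLocalRing (End (Z i))] :
    ∃ θ : ExtOf S.E (Z i) K, S.IsAlmostVanishing θ := by
  have hdet : ∀ (T : 𝒞) (g : T ⟶ Y),
      (∀ j (h : Z j ⟶ T), FactorsThrough (h ≫ g) α) → FactorsThrough g α := by
    refine fun T g hg => hC.1 T g fun h => ?_
    have : FactorsThrough ((e.inv ≫ h) ≫ g) α := factorsThrough_biproduct fun j => by
      rw [← Category.assoc]
      exact hg j _
    simpa using this.comp_left e.hom
  -- Otherwise `C` would be a summand of its own complement to `Z i`, and cancellation would give `Z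
  -- i = 0`.
  have hnot : ¬ IsRightDeterminer (⨁ (fun j : {j // j ≠ i} => Z j)) α := fun h =>
    not_isZero_of_isLocalRing_end (L := Z i)
      (hKS.isZero_of_isDirectSummand (e ≪≫ biproductIsoBiprodSubtype Z i) (hC.2 _ h))
  simp only [IsRightDeterminer, not_forall] at hnot
  obtain ⟨T, g, hg, hgα⟩ := hnot
  have hg' : ∀ j, j ≠ i → ∀ h : Z j ⟶ T, FactorsThrough (h ≫ g) α := fun j hj h => by
    classical
    have := (hg (biproduct.desc fun l : {l // l ≠ i} =>
      if hl : l = ⟨j, hj⟩ then eqToHom (by rw [hl]) ≫ h else 0)).comp_left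
        (biproduct.ι (fun l : {l // l ≠ i} => Z l) ⟨j, hj⟩)
    simpa using this
  have : Module.Finite k (ExtOf S.E (Z i) K) := hfin _ _
  -- The condition on `f` keeps the tests from the other summands satisfied after any
  -- precomposition. A nonzero member is `(h ≫ g)^⋆ δ` for some `h : Z i ⟶ T`.
  obtain ⟨θ, ⟨f, rfl, hf⟩, hθ0, hθ⟩ := exists_pull_eq_zero_of_not_isIso
    {θ : ExtOf S.E (Z i) K | ∃ f : Z i ⟶ Y, pull S.E K f δ = θ ∧
      ∀ j, j ≠ i → ∀ h : Z j ⟶ Z i, FactorsThrough (h ≫ f) α}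
    (by
      rintro _ ⟨f, rfl, hf⟩ r
      refine ⟨r ≫ f, S.pull_comp K r f δ, fun j hj h => ?_⟩
      rw [← Category.assoc]
      exact hf j hj _)
    (by
      by_contra! hcon
      refine hgα (hdet T g fun j h => ?_)
      by_cases hj : j = i
      · subst hj
        rw [factorsThrough_iff hδ]
        refine hcon _ ⟨h ≫ g, rfl, fun l hl u => ?_⟩
        rw [← Category.assoc]
        exact hg' l hl _
      · exact hg' j hj h)
  -- For a non-retraction `r`, no `h ≫ r` with `h : Z i ⟶ T'` is invertible, so the tests from `Z i`
  -- also succeed and `r ≫ f` factors through `α`.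
  refine ⟨_, hθ0, fun {T'} r hr => ?_⟩
  rw [← pull_comp, ← factorsThrough_iff hδ]
  refine hdet T' _ fun j h => ?_
  rw [← Category.assoc]
  by_cases hj : j = i
  · subst hj
    rw [factorsThrough_iff hδ, pull_comp]
    refine hθ _ fun hiso => hr (inv (h ≫ r) ≫ h) ?_
    rw [Category.assoc, IsIso.inv_hom_id]
  · exact hf j hj _

/-- Push `θ` to an indecomposable summand of `K` where it stays nonzero; vanishing of pullbacks
survives because push and pull commute. -/
theorem IsAlmostVanishing.exists_local (hKS : IsKrullSchmidt 𝒞) {K C : 𝒞}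
    {θ : ExtOf S.E C K} (hθ : S.IsAlmostVanishing θ) :
    ∃ (A : 𝒞) (_ : IsLocalRing (End A)) (η : ExtOf S.E C A), S.IsAlmostVanishing η := by
  obtain ⟨n, W, hW, ⟨e⟩⟩ := hKS K
  have : ∃ j, push S.E C (e.hom ≫ biproduct.π W j) θ ≠ 0 := by
    by_contra! h
    refine hθ.ne_zero ?_
    have h1 : push S.E C e.hom θ = 0 := eq_zero_of_push_π_eq_zero fun j => by
      rw [← push_comp_apply, h]
    rw [← push_id S K C θ, ← e.hom_inv_id, push_comp_apply, h1, map_zero]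
  obtain ⟨j, hj⟩ := this
  exact ⟨W j, hW j, _, hj, fun r hr => by rw [← push_pull, hθ.pull_eq_zero r hr, map_zero]⟩

/-- Every morphism `P ⟶ Y` factors through `α`, as its obstruction lies in 𝔼(P, K) = 0. So the
complement of `P` already determines `α`. -/
theorem isZero_of_isProjectiveObj_of_isDirectSummand (hKS : IsKrullSchmidt 𝒞) {K X Y : 𝒞}
    {ι : K ⟶ X} {α : X ⟶ Y} {δ : ExtOf S.E Y K} (hδ : S.s δ = seqClass ι α) {C : 𝒞}
    (hC : IsMinimalRightDeterminer C α) {P : 𝒞} (hPC : IsDirectSummand P C)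
    (hP : S.IsProjectiveObj P) : IsZero P := by
  obtain ⟨Z, ⟨e⟩⟩ := hPC
  refine hKS.isZero_of_isDirectSummand e (hC.2 Z fun T g hg => hC.1 T g fun h => ?_)
  have h1 : FactorsThrough (((biprod.inl : P ⟶ P ⊞ Z) ≫ e.inv ≫ h) ≫ g) α := by
    rw [factorsThrough_iff hδ, ← pull_id S K P (pull S.E K _ δ), hP K, LinearMap.zero_apply]
  have h2 := hg ((biprod.inr : Z ⟶ P ⊞ Z) ≫ e.inv ≫ h)
  obtain ⟨s, hs⟩ := h1
  obtain ⟨t, ht⟩ := h2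
  exact ⟨e.hom ≫ biprod.desc s t, by
    rw [Category.assoc, ← Iso.eq_inv_comp]
    ext
    · simpa using hs
    · simpa using ht⟩

end Extriangulated

theorem corollary4p7 {k : Type v} [CommRing k] [IsArtinianRing k]
    {𝒞 : Type u} [Category.{v} 𝒞] [Preadditive 𝒞] [Linear k 𝒞] [HasFiniteBiproducts 𝒞]
    (S : Extriangulated k 𝒞) (hKS : IsKrullSchmidt 𝒞) (hfin : S.ExtFinite) (hWIC : S.WIC)
    {X Y : 𝒞} (α : X ⟶ Y) (hα : S.IsDeflation α)
    (C : 𝒞) (hC : IsMinimalRightDeterminer C α) :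
    (∀ P : 𝒞, IsDirectSummand P C → S.IsProjectiveObj P → IsZero P) ∧ S.Cr C := by
  obtain ⟨K, ι, δ, hδ⟩ := hα
  refine ⟨fun P h1 h2 =>
    Extriangulated.isZero_of_isProjectiveObj_of_isDirectSummand hKS hδ hC h1 h2, ?_⟩
  obtain ⟨n, Z, hZ, ⟨e⟩⟩ := hKS C
  have h : ∀ i, S.HasDual (Z i) := fun i => by
    have := hZ i
    obtain ⟨θ, hθ⟩ := Extriangulated.exists_isAlmostVanishing hKS hfin hδ hC e i
    obtain ⟨A, _, η, hη⟩ := hθ.exists_local hKS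
    exact hη.hasDual
  exact ((Extriangulated.HasDual.biproduct h).of_iso e.symm).cr hfin
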